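/- **Theorem (sample average approximation for $q$EHVI).** *Setting.* Let $\mathcal X\subset\mathbb R^d$ be nonempty and compact, and let $\mathcal X^q\subset\mathbb R^{qd}$ be the set of stacked candidates $x=(x_1,\dots,x_q)$ with all $x_i\in\mathcal X$. Let $f$ be an $M$-output Gaussian process on $\mathbb R^d$ whose mean function $\mu_0:\mathbb R^d\to\mathbb R^M$ and matrix-valued covariance function $k:\mathbb R^d\times\mathbb R^d\to\mathbb R^{M\times M}$ are continuously differentiable. Given data $(X_i,Y_i)_{i=1}^n$ with $Y_i=f(X_i)+\eta_i$ and Gaussian noise $\eta\sim\mathcal N(0,\Lambda)$, $\Lambda\succeq 0$ ($\Lambda=0$ is allowed), let $f(x)=(f(x_1),\dots,f(x_q))\in\mathbb R^{qM}$ have the posterior law $\mathcal N(\mu(x),\Sigma(x))$, where $$\mu(x)=\mu_0(x)+k(x,X)K^{+}\bigl(Y-\mu_0(X)\bigr),\quad \Sigma(x)=k(x,x)-k(x,X)K^{+}k(X,x),\quad K=k(X,X)+\Lambda ,$$ all quantities being stacked over points and outputs, and $K^+$ being the Moore–Penrose inverse ($=K^{-1}$ if $K$ is nonsingular). Let $L(x)\in\mathbb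 R^{qM\times qM}$ be any root of the posterior covariance, $L(x)L(x)^T=\Sigma(x)$ for $x\in\mathcal X^q$ (for example a Cholesky factor). For a reference point $r\in\mathbb R^M$ and a finite set $S\subset\mathbb R^M$ let $\mathrm{HV}(S,r)=\lambda_M\bigl(\bigcup_{y\in S}[r,y]\bigr)$, where $\lambda_M$ is Lebesgue measure and $[r,y]=\{z: r\le z\le y \text{ componentwise}\}$. Fix $r$ and a finite (approximate Pareto) set $\mathcal P\subset\mathbb R^M$, and put $\mathrm{HVI}(\{y_i\}_{i=1}^q)=\mathrm{HV}(\mathcal P\cup\{y_i\}_{i=1}^q,r)-\mathrm{HV}(\mathcal P,r)$. Define $$\alpha_{q\mathrm{EHVI}}(x)=\mathbb E\bigl[\mathrm{HVI}(\{f(x_i)\}_{i=1}^q)\bigr],\qquad \hat\alpha^N_{q\mathrm{EHVI}}(x)=\frac1N\sum_{t=1}^N\mathrm{HVI}\bigl(\{f_t(x_i)\}_{i=1}^q\bigr),\qquad f_t(x)=\mu(x)+L(x)\epsilon_t,$$ where the expectation is over the posterior and $\epsilon_1,\epsilon_2,\dots$ are i.i.d. $\mathcal N(0,I_{qM})$.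 *Claim.* The expectation $\alpha_{q\mathrm{EHVI}}(x)$ exists for every $x\in\mathcal X^q$, and the set $\mathcal X^*=\arg\max_{x\in\mathcal X^q}\alpha_{q\mathrm{EHVI}}(x)$ is nonempty. Let $\alpha^*_{q\mathrm{EHVI}}=\max_{x\in\mathcal X^q}\alpha_{q\mathrm{EHVI}}(x)$. If for every $N\ge1$, almost surely, $\hat x^*_N\in\arg\max_{x\in\mathcal X^q}\hat\alpha^N_{q\mathrm{EHVI}}(x)$, then, as $N\to\infty$, 1. $\alpha_{q\mathrm{EHVI}}(\hat x^*_N)\to\alpha^*_{q\mathrm{EHVI}}$ almost surely; 2. $\mathrm{dist}(\hat x^*_N,\mathcal X^*)\to0$ almost surely. -/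

import Mathlib

open MeasureTheory ProbabilityTheory Filter Topology

noncomputable section

namespace QEHVI

/-- The design space `ℝ^d`. -/
abbrev Design (d : ℕ) : Type := EuclideanSpace ℝ (Fin d)

/-- Stacked candidate sets `x = (x_1, …, x_q) ∈ ℝ^{qd}`, with the Euclidean norm of `ℝ^{qd}`. -/
abbrev Batch (d q : ℕ) : Type := PiLp 2 (fun _ : Fin q => Design d)

/-- `𝒳^q`: the batches all of whose `q` candidates lie in the search space `𝒳`. -/
def batches {d : ℕ} (𝒳 : Set (Design d)) (q : ℕ) : Set (Batch d q) :=
  {x | ∀ i, x i ∈ 𝒳}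

/-! ### Hypervolume -/

/-- Hypervolume indicator: the Lebesgue measure of `⋃_{y ∈ S} [r, y]`. The box `[r, y]` is empty
unless `r ≤ y` componentwise. -/
def HV {M : ℕ} (r : Fin M → ℝ) (S : Set (Fin M → ℝ)) : ℝ :=
  volume.real (⋃ y ∈ S, Set.Icc r y)

/-- Hypervolume improvement of the `q` outcome vectors `y_1, …, y_q` over the finite set `F`:
`HV(F ∪ {y_1, …, y_q}, r) - HV(F, r)`. -/
def HVI {M q : ℕ} (r : Fin M → ℝ) (F : Finset (Fin M → ℝ)) (y : Fin q → Fin M → ℝ) : ℝ :=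
  HV r (↑F ∪ Set.range y) - HV r ↑F

/-! ### The multi-output Gaussian process surrogate -/

section GP

variable {d M : ℕ} {Ω : Type*} [MeasurableSpace Ω]

/-- Mean function of the `M`-output process `f`. -/
def gpMean (f : Design d → Ω → Fin M → ℝ) (P : Measure Ω) (x : Design d) : Fin M → ℝ :=
  fun m => ∫ ω, f x ω m ∂P

/-- Matrix-valued covariance function of the `M`-output process `f`. -/
def gpCov (f : Design d → Ω → Fin M → ℝ) (P : Measure Ω) (x x' : Design d) :
    Matrix (Fin M) (Fin M) ℝ :=
  Matrix.of fun m m' => cov[fun ω => f x ω m, fun ω => f x' ω m'; P]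

/-- The stacked covariance matrix of the values at `u_1, …, u_a` with those at `v_1, …, v_b`. -/
def stackCov (k : Design d → Design d → Matrix (Fin M) (Fin M) ℝ) {a b : ℕ}
    (u : Fin a → Design d) (v : Fin b → Design d) : Matrix (Fin a × Fin M) (Fin b × Fin M) ℝ :=
  Matrix.of fun p p' => k (u p.1) (v p'.1) p.2 p'.2

/-- Moore–Penrose inverse of a real symmetric matrix: nonzero eigenvalues are inverted and zero
eigenvalues are kept (in `ℝ`, `0⁻¹ = 0`). -/
def symmPinv {ι : Type*} [Fintype ι] [DecidableEq ι] (A : Matrix ι ι ℝ) : Matrix ι ι ℝ :=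
  cfc (fun t : ℝ => t⁻¹) A

/-- For a nonsingular symmetric matrix `symmPinv` is the ordinary inverse. -/
theorem symmPinv_eq_inv {ι : Type*} [Fintype ι] [DecidableEq ι] {A : Matrix ι ι ℝ}
    (hA : A.IsHermitian) (hu : IsUnit A) : symmPinv A = A⁻¹ := by
  obtain ⟨u, rfl⟩ := hu
  have h := cfc_inv_id (R := ℝ) u hA
  rw [Matrix.coe_units_inv] at h
  exact h

/-- Posterior mean, at the stacked candidates `x`, of a Gaussian process with prior mean `μ₀` and
prior covariance `k`, given the observations `Y i = f (X i) + η i`, `i = 1, …, n`, with Gaussian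
noise `η ∼ N(0, Λ)` (`Λ = 0` for noiseless observations). -/
def postMean (μ₀ : Design d → Fin M → ℝ) (k : Design d → Design d → Matrix (Fin M) (Fin M) ℝ)
    {n q : ℕ} (X : Fin n → Design d) (Y : Fin n → Fin M → ℝ)
    (Λ : Matrix (Fin n × Fin M) (Fin n × Fin M) ℝ) (x : Batch d q) : Fin q × Fin M → ℝ :=
  (fun p => μ₀ (x p.1) p.2) +
    (stackCov k (fun i => x i) X * symmPinv (stackCov k X X + Λ)).mulVec
      (fun p => Y p.1 p.2 - μ₀ (X p.1) p.2)

/-- Posterior covariance matrix at the stacked candidates `x`, for the same observation model. -/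
def postCov (k : Design d → Design d → Matrix (Fin M) (Fin M) ℝ)
    {n q : ℕ} (X : Fin n → Design d) (Λ : Matrix (Fin n × Fin M) (Fin n × Fin M) ℝ)
    (x : Batch d q) : Matrix (Fin q × Fin M) (Fin q × Fin M) ℝ :=
  stackCov k (fun i => x i) (fun i => x i) -
    stackCov k (fun i => x i) X * symmPinv (stackCov k X X + Λ) * stackCov k X (fun i => x i)

end GP

/-! ### The acquisition function and its Monte-Carlo estimator -/

section Acquisition

variable {d q M : ℕ}

/-- The joint posterior law `N(μ(x), Σ(x))` of the stacked outcomes at the candidates `x`. -/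
def postLaw (μ : Batch d q → Fin q × Fin M → ℝ)
    (S : Batch d q → Matrix (Fin q × Fin M) (Fin q × Fin M) ℝ) (x : Batch d q) :
    Measure (EuclideanSpace ℝ (Fin q × Fin M)) :=
  multivariateGaussian (WithLp.toLp 2 (μ x)) (S x)

/-- The hypervolume improvement of a stacked outcome vector `v ∈ ℝ^{qM}`. -/
def stackedHVI (r : Fin M → ℝ) (F : Finset (Fin M → ℝ))
    (v : EuclideanSpace ℝ (Fin q × Fin M)) : ℝ :=
  HVI r F (fun i m => v (i, m))

/-- `α_qEHVI(x) = 𝔼[HVI(f(x_1), …, f(x_q))]`, the expectation being over the posterior. -/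
def qEHVI (r : Fin M → ℝ) (F : Finset (Fin M → ℝ)) (μ : Batch d q → Fin q × Fin M → ℝ)
    (S : Batch d q → Matrix (Fin q × Fin M) (Fin q × Fin M) ℝ) (x : Batch d q) : ℝ :=
  ∫ v, stackedHVI r F v ∂(postLaw μ S x)

/-- The reparameterized sample `μ(x) + L(x) ε` of the stacked outcomes. -/
def sample (μ : Batch d q → Fin q × Fin M → ℝ)
    (L : Batch d q → Matrix (Fin q × Fin M) (Fin q × Fin M) ℝ) (x : Batch d q)
    (ε : EuclideanSpace ℝ (Fin q × Fin M)) : EuclideanSpace ℝ (Fin q × Fin M) :=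
  WithLp.toLp 2 (μ x + (L x).mulVec (WithLp.ofLp ε))

/-- The Monte-Carlo estimator `α̂^N_qEHVI(x)`, computed from the first `N` of the base samples
`e 0, e 1, …`. -/
def qEHVIEstimator (r : Fin M → ℝ) (F : Finset (Fin M → ℝ)) (μ : Batch d q → Fin q × Fin M → ℝ)
    (L : Batch d q → Matrix (Fin q × Fin M) (Fin q × Fin M) ℝ)
    (e : ℕ → EuclideanSpace ℝ (Fin q × Fin M)) (N : ℕ) (x : Batch d q) : ℝ :=
  (1 / (N : ℝ)) * ∑ t ∈ Finset.range N, stackedHVI r F (sample μ L x (e t))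

end Acquisition

/-- `argmax_{x ∈ K} g(x)`. -/
def argmaxOn {α : Type*} (g : α → ℝ) (K : Set α) : Set α :=
  {x | x ∈ K ∧ ∀ y ∈ K, g y ≤ g x}

end QEHVI

end

namespace QEHVI

/-! ### Continuity and growth of the hypervolume -/

/-! The root `L` is arbitrary, possibly discontinuous in `x`, so a uniform law of large numbers
cannot be run over `x` directly. Instead the pair (mean, root) is the parameter. By
`exists_bound_mean_root` these pairs stay in a compact ball, on which the sampled improvement is
jointly continuous and dominated by a polynomial in the norm of the base sample. The strong law in
the Banach space of continuous functions on that ball (`ae_tendstoUniformly_average`) gives uniform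
convergence there; substituting `(μ x, L x)` then needs no regularity of `L`.

The acquisition function is nevertheless continuous in `x`: the expectation depends on a root `A`
only through `A * Aᵀ` (`expectedHVI_eq`), which is continuous along `x`, and
`continuous_comp_of_fibers` turns this into continuity by compactness. Existence of a maximizer and
both convergences follow from compactness of the batches. -/

theorem eventually_mem_iUnion_Icc_iff {ι κ : Type*} [Finite ι] [Finite κ] (r : κ → ℝ)
    (y₀ : ι → κ → ℝ) {z : κ → ℝ} (hz : ∀ i m, z m ≠ y₀ i m) :
    ∀ᶠ y in 𝓝 y₀, (z ∈ ⋃ w ∈ Set.range y, Set.Icc r w) ↔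
      z ∈ ⋃ w ∈ Set.range y₀, Set.Icc r w := by
  have key : ∀ᶠ y in 𝓝 y₀, ∀ i m, (z m ≤ y i m ↔ z m ≤ y₀ i m) := by
    refine eventually_all.2 fun i => eventually_all.2 fun m => ?_
    have hc : Tendsto (fun y : ι → κ → ℝ => y i m) (𝓝 y₀) (𝓝 (y₀ i m)) :=
      Continuous.tendsto (by fun_prop) y₀
    rcases lt_or_gt_of_ne (hz i m) with h | h
    · filter_upwards [hc.eventually (lt_mem_nhds h)] with y hy
      exact ⟨fun _ => h.le, fun _ => hy.le⟩
    · filter_upwards [hc.eventually (gt_mem_nhds h)] with y hy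
      exact ⟨fun hh => absurd hy hh.not_gt, fun hh => absurd h hh.not_gt⟩
  filter_upwards [key] with y hy
  simp only [Set.mem_iUnion, Set.mem_range, exists_prop, exists_exists_eq_and, Set.mem_Icc,
    Pi.le_def, hy]

/-- Dominated convergence for indicators: a point `z` sharing no coordinate with a corner of `y₀`
satisfies only strict inequalities, which survive small perturbations, and the remaining `z` lie on
finitely many null hyperplanes. -/
theorem continuous_HV_union_range {M q : ℕ} (r : Fin M → ℝ) (F : Finset (Fin M → ℝ)) :
    Continuous fun y : Fin q → Fin M → ℝ => HV r (↑F ∪ Set.range y) := by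
  set U : Set (Fin M → ℝ) := ⋃ w ∈ (F : Set (Fin M → ℝ)), Set.Icc r w with hU
  have hUm : MeasurableSet U := F.measurableSet_biUnion fun _ _ => measurableSet_Icc
  have hVm : ∀ y : Fin q → Fin M → ℝ, MeasurableSet (⋃ w ∈ Set.range y, Set.Icc r w) := fun y =>
    (Set.finite_range y).measurableSet_biUnion fun _ _ => measurableSet_Icc
  have hUfin : volume U ≠ ⊤ := by
    refine ((measure_biUnion_finset_le F _).trans_lt ?_).ne
    exact ENNReal.sum_lt_top.2 fun w _ => isCompact_Icc.measure_lt_top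
  have hrep : (fun y : Fin q → Fin M → ℝ => HV r (↑F ∪ Set.range y)) = fun y =>
      ∫ z, (U ∪ ⋃ w ∈ Set.range y, Set.Icc r w).indicator (1 : (Fin M → ℝ) → ℝ) z := by
    funext y
    rw [integral_indicator_one (hUm.union (hVm y)), HV, Set.biUnion_union]
  rw [hrep, continuous_iff_continuousAt]
  intro y₀
  -- One box of finite volume that contains all new boxes for `y` near `y₀`.
  set B : Set (Fin M → ℝ) := Set.Icc r fun _ => ‖y₀‖ + 1
  refine continuousAt_of_dominated (bound := (U ∪ B).indicator 1) ?_ ?_ ?_ ?_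
  · exact Eventually.of_forall fun y =>
      (measurable_one.indicator (hUm.union (hVm y))).aestronglyMeasurable
  · have hev : ∀ᶠ y in 𝓝 y₀, ‖y‖ < ‖y₀‖ + 1 :=
      continuous_norm.continuousAt.eventually (gt_mem_nhds (by linarith))
    filter_upwards [hev] with y hy
    refine Eventually.of_forall fun z => ?_
    have hsub : (U ∪ ⋃ w ∈ Set.range y, Set.Icc r w) ⊆ U ∪ B := by
      refine Set.union_subset_union_right U (Set.iUnion₂_subset ?_)
      rintro _ ⟨i, rfl⟩
      refine Set.Icc_subset_Icc_right fun m => ?_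
      have h1 := norm_le_pi_norm (y i) m
      have h2 := norm_le_pi_norm y i
      exact (le_abs_self _).trans (by rw [← Real.norm_eq_abs]; linarith)
    rw [Real.norm_of_nonneg (Set.indicator_nonneg (f := (1 : (Fin M → ℝ) → ℝ)) (fun _ _ => zero_le_one) z)]
    exact Set.indicator_le_indicator_of_subset hsub (fun _ => zero_le_one) z
  · refine (integrable_indicator_iff (hUm.union measurableSet_Icc)).2 ?_
    exact integrableOn_const (measure_union_lt_top hUfin.lt_top isCompact_Icc.measure_lt_top).ne
  · have hae : ∀ᵐ z : Fin M → ℝ, ∀ i m, z m ≠ y₀ i m :=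
      ae_all_iff.2 fun i => ae_all_iff.2 fun m => Measure.ae_eval_ne (fun _ : Fin M => (volume : Measure ℝ)) m (y₀ i m)
    filter_upwards [hae] with z hz
    refine tendsto_const_nhds.congr' ?_
    filter_upwards [eventually_mem_iUnion_Icc_iff r y₀ hz] with y hy
    have hiff : (z ∈ U ∪ ⋃ w ∈ Set.range y, Set.Icc r w) ↔
        z ∈ U ∪ ⋃ w ∈ Set.range y₀, Set.Icc r w := or_congr_right hy
    by_cases hmem : z ∈ U ∪ ⋃ w ∈ Set.range y₀, Set.Icc r w
    · rw [Set.indicator_of_mem hmem, Set.indicator_of_mem (hiff.2 hmem)]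
    · rw [Set.indicator_of_notMem hmem, Set.indicator_of_notMem (hiff.not.2 hmem)]

theorem continuous_stackedHVI {M q : ℕ} (r : Fin M → ℝ) (F : Finset (Fin M → ℝ)) :
    Continuous (stackedHVI (q := q) r F) := by
  have h : Continuous fun v : EuclideanSpace ℝ (Fin q × Fin M) =>
      (fun i m => v (i, m) : Fin q → Fin M → ℝ) := by fun_prop
  exact ((continuous_HV_union_range r F).comp h).sub continuous_const

theorem stackedHVI_nonneg {M q : ℕ} (r : Fin M → ℝ) (F : Finset (Fin M → ℝ))
    (v : EuclideanSpace ℝ (Fin q × Fin M)) : 0 ≤ stackedHVI r F v := by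
  refine sub_nonneg.2 (measureReal_mono (Set.biUnion_subset_biUnion_left Set.subset_union_left) ?_)
  have hfin : (↑F ∪ Set.range fun i m => v (i, m) : Set (Fin M → ℝ)).Finite :=
    F.finite_toSet.union (Set.finite_range _)
  exact (measure_biUnion_lt_top hfin fun _ _ => isCompact_Icc.measure_lt_top).ne

/-- By subadditivity the improvement is at most the volume of the new boxes, all inside one box with
sides at most `‖v‖ + ‖r‖`. This polynomial growth is what Gaussian moments can absorb. -/
theorem stackedHVI_le {M q : ℕ} (r : Fin M → ℝ) (F : Finset (Fin M → ℝ))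
    (v : EuclideanSpace ℝ (Fin q × Fin M)) : stackedHVI r F v ≤ (‖v‖ + ‖r‖) ^ M := by
  have hsub : (⋃ w ∈ Set.range (fun i m => v (i, m) : Fin q → Fin M → ℝ), Set.Icc r w) ⊆
      Set.Icc r fun _ => ‖v‖ := by
    refine Set.iUnion₂_subset ?_
    rintro _ ⟨i, rfl⟩
    exact Set.Icc_subset_Icc_right fun m => (le_abs_self _).trans (PiLp.norm_apply_le v (i, m))
  have hbox : volume.real (Set.Icc r fun _ : Fin M => ‖v‖) ≤ (‖v‖ + ‖r‖) ^ M := by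
    rw [measureReal_def, Real.volume_Icc_pi]
    refine ENNReal.toReal_le_of_le_ofReal (by positivity) ?_
    have : ∏ i, ENNReal.ofReal (‖v‖ - r i) ≤ ∏ _i : Fin M, ENNReal.ofReal (‖v‖ + ‖r‖) := by
      refine Finset.prod_le_prod' fun i _ => ENNReal.ofReal_le_ofReal ?_
      have := (neg_le_abs (r i)).trans (norm_le_pi_norm r i)
      linarith
    refine this.trans_eq ?_
    rw [Finset.prod_const, Finset.card_univ, Fintype.card_fin, ENNReal.ofReal_pow (by positivity)]
  unfold stackedHVI HVI HV
  rw [Set.biUnion_union]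
  have h1 := measureReal_union_le (μ := volume) (⋃ w ∈ (F : Set (Fin M → ℝ)), Set.Icc r w)
    (⋃ w ∈ Set.range (fun i m => v (i, m) : Fin q → Fin M → ℝ), Set.Icc r w)
  have h2 := measureReal_mono (μ := volume) hsub isCompact_Icc.measure_lt_top.ne
  linarith

/-! ### The reparameterization of a multivariate Gaussian -/

section Reparam

variable {ι : Type*} [Fintype ι] [DecidableEq ι]

/-- Both sides are Gaussian, so comparing means and covariance forms suffices; `A` may be singular.
-/
theorem stdGaussian_map_affine (m : ι → ℝ) (A : Matrix ι ι ℝ) :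
    (stdGaussian (EuclideanSpace ℝ ι)).map
        (fun e => WithLp.toLp 2 (m + A.mulVec (WithLp.ofLp e))) =
      multivariateGaussian (WithLp.toLp 2 m) (A * A.transpose) := by
  set T := Matrix.toEuclideanCLM (n := ι) (𝕜 := ℝ) A with hT
  have hfun : (fun e : EuclideanSpace ℝ ι => WithLp.toLp 2 (m + A.mulVec (WithLp.ofLp e))) =
      (fun e => WithLp.toLp 2 m + e) ∘ T := rfl
  have hpsd : (A * A.transpose).PosSemidef := Matrix.posSemidef_self_mul_conjTranspose A
  rw [hfun, ← Measure.map_map (measurable_const_add _) (by fun_prop)]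
  refine IsGaussian.ext ?_ ?_
  · rw [integral_id_multivariateGaussian', integral_map (by fun_prop) (by fun_prop),
      integral_map (by fun_prop) (by fun_prop)]
    simp only [id_eq]
    rw [integral_add (f := fun _ => WithLp.toLp 2 m) (g := T) (integrable_const _)
        (T.integrable_comp IsGaussian.integrable_id),
      T.integral_comp_id_comm IsGaussian.integrable_id]
    simp
  · ext x y
    rw [covarianceBilin_map_const_add, covarianceBilin_map IsGaussian.memLp_two_id,
      covarianceBilin_stdGaussian, covarianceBilin_multivariateGaussian hpsd,
      innerSL_apply_apply, ContinuousLinearMap.adjoint_inner_left,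
      ← ContinuousLinearMap.star_eq_adjoint, hT, ← map_star,
      ← ContinuousLinearMap.comp_apply, ← ContinuousLinearMap.mul_def, ← map_mul,
      Matrix.inner_toEuclideanCLM]
    rfl

end Reparam

/-! ### Uniform strong law of large numbers -/

/-- Currying `h` gives i.i.d. random elements of the separable Banach space `C(Θ, ℝ)`, Bochner
integrable thanks to `H`. The vector-valued strong law converges in sup norm, that is, uniformly in
`θ`. -/
theorem ae_tendstoUniformly_average {Θ E Ω : Type*} [TopologicalSpace Θ] [CompactSpace Θ]
    [SecondCountableTopology Θ] [R1Space Θ] [TopologicalSpace E] [MeasurableSpace E] [BorelSpace E]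
    [MeasurableSpace Ω] {P : Measure Ω} {ν : Measure E}
    {h : E → Θ → ℝ} (hcont : Continuous (Function.uncurry h))
    {H : E → ℝ} (hH : Integrable H ν) (hbound : ∀ e θ, |h e θ| ≤ H e)
    {ε : ℕ → Ω → E} (hindep : iIndepFun ε P) (hlaw : ∀ t, HasLaw (ε t) ν P) :
    ∀ᵐ ω ∂P, TendstoUniformly (fun (N : ℕ) θ => (1 / (N : ℝ)) * ∑ t ∈ Finset.range N, h (ε t ω) θ)
      (fun θ => ∫ e, h e θ ∂ν) atTop := by
  borelize C(Θ, ℝ)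
  set c : C(E, C(Θ, ℝ)) := ContinuousMap.curry ⟨Function.uncurry h, hcont⟩ with hc
  have hcm : Measurable c := c.continuous.measurable
  have hcint : Integrable c ν := by
    refine hH.abs.mono' hcm.aestronglyMeasurable (Eventually.of_forall fun e => ?_)
    exact (ContinuousMap.norm_le _ (abs_nonneg _)).2 fun θ => (hbound e θ).trans (le_abs_self _)
  have hmap : ∀ t, P.map (ε t) = ν := fun t => (hlaw t).map_eq
  have hint : Integrable (c ∘ ε 0) P := by
    rw [← hmap 0] at hcint
    exact hcint.comp_aemeasurable (hlaw 0).aemeasurable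
  have hslln := strong_law_ae (fun t => c ∘ ε t) hint
    (fun i j hij => (hindep.indepFun hij).comp hcm hcm)
    (fun i => ((hlaw i).identDistrib (hlaw 0)).comp hcm)
  have hlim : (∫ ω, (c ∘ ε 0) ω ∂P) = ∫ e, c e ∂ν := by
    rw [← hmap 0, integral_map (hlaw 0).aemeasurable hcm.aestronglyMeasurable]
    rfl
  filter_upwards [hslln] with ω hω
  rw [hlim, ContinuousMap.tendsto_iff_tendstoUniformly] at hω
  convert hω using 2 with N θ
  · simp [hc]
  -- Evaluation at `θ` commutes with the Bochner integral.
  · exact (ContinuousMap.integral_apply hcint θ).symm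

theorem continuous_integral_of_dominated {Θ E : Type*} [TopologicalSpace Θ]
    [FirstCountableTopology Θ] [TopologicalSpace E] [SecondCountableTopology E] [MeasurableSpace E]
    [BorelSpace E] {ν : Measure E} {h : E → Θ → ℝ} (hcont : Continuous (Function.uncurry h))
    {H : E → ℝ} (hH : Integrable H ν) (hbound : ∀ e θ, |h e θ| ≤ H e) :
    Continuous fun θ => ∫ e, h e θ ∂ν :=
  continuous_of_dominated
    (fun _ => (hcont.comp (continuous_id.prodMk continuous_const)).aestronglyMeasurable)
    (fun θ => Eventually.of_forall fun e => hbound e θ) hH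
    (Eventually.of_forall fun _ => hcont.comp (continuous_const.prodMk continuous_id))

/-! ### Continuity through a non-injective compact parameterization -/

/-- Here `θ` may be discontinuous. Along an ultrafilter tending to `x`, compactness gives `θ` some
limit `a`; it may differ from `θ x`, but it lies in the same fiber of `c`, where `g` is constant. -/
theorem continuous_comp_of_fibers {α Θ Z W : Type*} [TopologicalSpace α] [TopologicalSpace Θ]
    [CompactSpace Θ] [TopologicalSpace Z] [T2Space Z] [TopologicalSpace W]
    {θ : α → Θ} {c : Θ → Z} (hc : Continuous c) (hcθ : Continuous fun x => c (θ x))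
    {g : Θ → W} (hg : Continuous g) (hfib : ∀ a b, c a = c b → g a = g b) :
    Continuous fun x => g (θ x) := by
  refine continuous_iff_ultrafilter.2 fun x U hU => ?_
  obtain ⟨a, -, ha⟩ := isCompact_univ.ultrafilter_le_nhds (U.map θ) (by simp)
  have h1 : Tendsto (fun x => c (θ x)) U (𝓝 (c a)) := (hc.tendsto a).comp ha
  have h2 : Tendsto (fun x => c (θ x)) U (𝓝 (c (θ x))) := (hcθ.tendsto x).mono_left hU
  rw [hfib (θ x) a (tendsto_nhds_unique h2 h1)]
  exact (hg.tendsto a).comp ha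

/-! ### Consistency of approximate maximizers -/

theorem argmaxOn_nonempty {α : Type*} [TopologicalSpace α] {K : Set α} (hK : IsCompact K)
    (hne : K.Nonempty) {g : α → ℝ} (hg : ContinuousOn g K) : (argmaxOn g K).Nonempty := by
  obtain ⟨x, hx, hmax⟩ := hK.exists_isMaxOn hne hg
  exact ⟨x, hx, fun y hy => hmax hy⟩

theorem sSup_image_eq_of_mem_argmaxOn {α : Type*} {K : Set α} {g : α → ℝ} {x : α}
    (hx : x ∈ argmaxOn g K) : sSup (g '' K) = g x :=
  IsGreatest.csSup_eq ⟨⟨x, hx.1, rfl⟩, by rintro _ ⟨y, hy, rfl⟩; exact hx.2 y hy⟩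

theorem tendsto_of_argmaxOn_of_tendstoUniformlyOn {α : Type*} {K : Set α} {g : α → ℝ}
    {gN : ℕ → α → ℝ} (hunif : TendstoUniformlyOn gN g atTop K) (hne : (argmaxOn g K).Nonempty)
    {x : ℕ → α} (hx : ∀ᶠ N in atTop, x N ∈ argmaxOn (gN N) K) :
    Tendsto (fun N => g (x N)) atTop (𝓝 (sSup (g '' K))) := by
  obtain ⟨a, ha⟩ := hne
  rw [sSup_image_eq_of_mem_argmaxOn ha, Metric.tendsto_nhds]
  intro δ hδ
  filter_upwards [Metric.tendstoUniformlyOn_iff.1 hunif (δ / 2) (half_pos hδ), hx] with N hN hxN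
  have h1 := hN a ha.1
  have h2 := hN (x N) hxN.1
  have h3 := hxN.2 a ha.1
  have h4 := ha.2 (x N) hxN.1
  -- `g (x N) > gN (x N) - δ/2 ≥ gN a - δ/2 > g a - δ`.
  rw [Real.dist_eq, abs_lt] at *
  constructor <;> linarith

theorem tendsto_infDist_argmaxOn {α : Type*} [PseudoMetricSpace α] {K : Set α}
    (hK : IsCompact K) {g : α → ℝ} (hg : ContinuousOn g K) (hne : (argmaxOn g K).Nonempty)
    {x : ℕ → α} (hx : ∀ᶠ N in atTop, x N ∈ K)
    (hlim : Tendsto (fun N => g (x N)) atTop (𝓝 (sSup (g '' K)))) :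
    Tendsto (fun N => Metric.infDist (x N) (argmaxOn g K)) atTop (𝓝 0) := by
  obtain ⟨a, ha⟩ := hne
  rw [sSup_image_eq_of_mem_argmaxOn ha] at hlim
  rw [Metric.tendsto_nhds]
  intro δ hδ
  -- On this compact set `g` stays strictly below its maximum over `K`, so convergence of values
  -- eventually expels `x N` from it.
  set C : Set α := K ∩ {y | δ ≤ Metric.infDist y (argmaxOn g K)}
  have hC : IsCompact C :=
    hK.inter_right (isClosed_le continuous_const (Metric.continuous_infDist_pt _))
  have key : ∀ᶠ N in atTop, x N ∉ C := by
    rcases C.eq_empty_or_nonempty with hCe | hCne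
    · simp [hCe]
    obtain ⟨b, hb, hbmax⟩ := hC.exists_isMaxOn hCne (hg.mono Set.inter_subset_left)
    have hlt : g b < g a := by
      by_contra! hle
      have hbA : b ∈ argmaxOn g K := ⟨hb.1, fun y hy => (ha.2 y hy).trans hle⟩
      have := hb.2
      rw [Set.mem_ofPred_eq, Metric.infDist_zero_of_mem hbA] at this
      linarith
    filter_upwards [hlim.eventually (lt_mem_nhds hlt)] with N hN hNC
    exact absurd (hbmax hNC) hN.not_ge
  filter_upwards [key, hx] with N hN hxN
  rw [Real.dist_0_eq_abs, abs_of_nonneg Metric.infDist_nonneg]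
  by_contra! hle
  exact hN ⟨hxN, hle⟩

/-! ### Regularity of the posterior -/

theorem isCompact_batches {d : ℕ} {𝒳 : Set (Design d)} (h𝒳 : IsCompact 𝒳) (q : ℕ) :
    IsCompact (batches 𝒳 q) := by
  have h := (isCompact_univ_pi fun _ : Fin q => h𝒳).image
    (PiLp.continuous_toLp 2 fun _ : Fin q => Design d)
  convert h using 1
  ext x
  constructor
  · exact fun hx => ⟨WithLp.ofLp x, fun i _ => hx i, rfl⟩
  · rintro ⟨y, hy, rfl⟩ i
    exact hy i trivial

theorem batches_nonempty {d : ℕ} {𝒳 : Set (Design d)} (hne : 𝒳.Nonempty) (q : ℕ) :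
    (batches 𝒳 q).Nonempty := by
  obtain ⟨a, ha⟩ := hne
  exact ⟨WithLp.toLp 2 fun _ => a, fun _ => ha⟩

section Posterior

variable {d M n q : ℕ} {k : Design d → Design d → Matrix (Fin M) (Fin M) ℝ}
  {X : Fin n → Design d} {Λ : Matrix (Fin n × Fin M) (Fin n × Fin M) ℝ}

theorem continuous_stackCov
    (hk : ∀ m m', Continuous fun z : Design d × Design d => k z.1 z.2 m m')
    {Z : Type*} [TopologicalSpace Z] {a b : ℕ} {u : Z → Fin a → Design d} {v : Z → Fin b → Design d}
    (hu : Continuous u) (hv : Continuous v) : Continuous fun z => stackCov k (u z) (v z) := by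
  refine continuous_matrix fun p p' => ?_
  exact (hk p.2 p'.2).comp (f := fun z => (u z p.1, v z p'.1)) (by fun_prop)

/-- The pseudo-inverse is a constant matrix in `x`, so its discontinuity as a matrix function is
harmless. -/
theorem continuous_postMean {μ₀ : Design d → Fin M → ℝ} (hμ₀ : Continuous μ₀)
    (hk : ∀ m m', Continuous fun z : Design d × Design d => k z.1 z.2 m m')
    (Y : Fin n → Fin M → ℝ) : Continuous (postMean (q := q) μ₀ k X Y Λ) := by
  have h1 : Continuous fun x : Batch d q => stackCov k (fun i => x i) X :=
    continuous_stackCov hk (by fun_prop) continuous_const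
  refine Continuous.add (by fun_prop) ?_
  exact (h1.matrix_mul continuous_const).matrix_mulVec continuous_const

theorem continuous_postCov
    (hk : ∀ m m', Continuous fun z : Design d × Design d => k z.1 z.2 m m') :
    Continuous (postCov (q := q) k X Λ) := by
  have hx : Continuous fun (x : Batch d q) (i : Fin q) => x i := by fun_prop
  exact (continuous_stackCov hk hx hx).sub
    (((continuous_stackCov hk hx continuous_const).matrix_mul continuous_const).matrix_mul
      (continuous_stackCov hk continuous_const hx))

end Posterior

theorem abs_le_of_mul_transpose_diag_le {ι : Type*} [Fintype ι] {A : Matrix ι ι ℝ} {B : ℝ}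
    (h : ∀ i, (A * A.transpose) i i ≤ B) (i j : ι) : |A i j| ≤ B + 1 := by
  have h1 : A i j ^ 2 ≤ (A * A.transpose) i i := by
    rw [Matrix.mul_apply]
    simp only [Matrix.transpose_apply, ← sq]
    exact Finset.single_le_sum (f := fun j => A i j ^ 2) (fun _ _ => sq_nonneg _)
      (Finset.mem_univ j)
  have h2 := h1.trans (h i)
  -- `B ≥ 0` as it bounds a square, and `B ≤ (B + 1) ^ 2` avoids a square root.
  refine abs_le_of_sq_le_sq ?_ ?_ <;> nlinarith [sq_nonneg (A i j)]

/-! ### The acquisition function as a function of posterior mean and covariance root -/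

section Affine

variable {ι : Type*} [Fintype ι]

/-- The affine image `m + A e` of a base sample `e`. -/
def affineSample (θ : (ι → ℝ) × (ι → ι → ℝ)) (e : EuclideanSpace ℝ ι) : EuclideanSpace ℝ ι :=
  WithLp.toLp 2 (θ.1 + (Matrix.of θ.2).mulVec (WithLp.ofLp e))

theorem continuous_affineSample :
    Continuous fun p : EuclideanSpace ℝ ι × ((ι → ℝ) × (ι → ι → ℝ)) => affineSample p.2 p.1 := by
  refine (PiLp.continuous_toLp 2 _).comp (Continuous.add (by fun_prop) ?_)
  refine Continuous.matrix_mulVec (continuous_matrix fun i j => ?_) (by fun_prop)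
  simp only [Matrix.of_apply]
  fun_prop

theorem affineSample_smul (s : ℝ) (m : ι → ℝ) (A : ι → ι → ℝ) (e : EuclideanSpace ℝ ι) :
    affineSample (s • m, A) (s • e) = s • affineSample (m, A) e := by
  simp only [affineSample, WithLp.ofLp_smul, Matrix.mulVec_smul, ← smul_add, WithLp.toLp_smul]

/-- The map is homogeneous in `(m, e)` for fixed `A`. Scaling both by `(1 + ‖e‖)⁻¹` lands in a
compact set, where continuity supplies `C`. -/
theorem exists_norm_affineSample_le (B : ℝ) : ∃ C, ∀ θ : (ι → ℝ) × (ι → ι → ℝ), ‖θ‖ ≤ B →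
    ∀ e : EuclideanSpace ℝ ι, ‖affineSample θ e‖ ≤ C * (1 + ‖e‖) := by
  obtain ⟨C, hC⟩ := ((isCompact_closedBall (0 : EuclideanSpace ℝ ι) 1).prod
    (isCompact_closedBall (0 : (ι → ℝ) × (ι → ι → ℝ)) B)).exists_bound_of_continuousOn
      continuous_affineSample.continuousOn
  refine ⟨C, fun ⟨m, A⟩ hθ e => ?_⟩
  have hpos : 0 < 1 + ‖e‖ := by positivity
  have hs : ‖(1 + ‖e‖)⁻¹‖ ≤ 1 := by
    rw [norm_inv, Real.norm_of_nonneg hpos.le]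
    exact inv_le_one_of_one_le₀ (by linarith [norm_nonneg e])
  have h := hC ((1 + ‖e‖)⁻¹ • e, ((1 + ‖e‖)⁻¹ • m, A)) ⟨?_, ?_⟩
  · rw [affineSample_smul, norm_smul, norm_inv, Real.norm_of_nonneg hpos.le,
      inv_mul_le_iff₀ hpos] at h
    linarith
  · rw [mem_closedBall_zero_iff, norm_smul, norm_inv, Real.norm_of_nonneg hpos.le,
      inv_mul_le_iff₀ hpos]
    linarith
  · rw [mem_closedBall_zero_iff]
    rw [Prod.norm_mk, max_le_iff] at hθ ⊢
    refine ⟨?_, hθ.2⟩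
    rw [norm_smul]
    exact (mul_le_of_le_one_left (norm_nonneg m) hs).trans hθ.1

end Affine

theorem integrable_affine_norm_pow {E : Type*} [NormedAddCommGroup E] [NormedSpace ℝ E]
    [SecondCountableTopology E] [CompleteSpace E] [MeasurableSpace E] [BorelSpace E]
    (ν : Measure E) [IsGaussian ν] (a b : ℝ) (M : ℕ) :
    Integrable (fun v => |a * ‖v‖ + b| ^ M) ν := by
  have h : MemLp (fun v : E => a * ‖v‖ + b) M ν :=
    ((IsGaussian.memLp_id ν M (by simp)).norm.const_mul a).add (memLp_const b)
  exact h.integrable_norm_pow'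

theorem integrable_stackedHVI {M q : ℕ} (r : Fin M → ℝ) (F : Finset (Fin M → ℝ))
    (ν : Measure (EuclideanSpace ℝ (Fin q × Fin M))) [IsGaussian ν] :
    Integrable (stackedHVI r F) ν := by
  refine (integrable_affine_norm_pow ν 1 ‖r‖ M).mono'
    (continuous_stackedHVI r F).aestronglyMeasurable (Eventually.of_forall fun v => ?_)
  rw [Real.norm_of_nonneg (stackedHVI_nonneg r F v), one_mul, abs_of_nonneg (by positivity)]
  exact stackedHVI_le r F v

/-! ### The sample average approximation -/

section SampleAverage

variable {q M : ℕ}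

/-- The expected hypervolume improvement as a function of the mean and of a root of the
covariance. -/
noncomputable def expectedHVI (r : Fin M → ℝ) (F : Finset (Fin M → ℝ))
    (θ : (Fin q × Fin M → ℝ) × (Fin q × Fin M → Fin q × Fin M → ℝ)) : ℝ :=
  ∫ e, stackedHVI r F (affineSample θ e) ∂(stdGaussian (EuclideanSpace ℝ (Fin q × Fin M)))

theorem expectedHVI_eq (r : Fin M → ℝ) (F : Finset (Fin M → ℝ))
    (θ : (Fin q × Fin M → ℝ) × (Fin q × Fin M → Fin q × Fin M → ℝ)) :
    expectedHVI r F θ = ∫ v, stackedHVI r F v ∂(multivariateGaussian (WithLp.toLp 2 θ.1)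
      (Matrix.of θ.2 * (Matrix.of θ.2).transpose)) := by
  have hm : Continuous (affineSample θ) := continuous_affineSample.comp (.prodMk_left θ)
  rw [← stdGaussian_map_affine]
  exact (integral_map hm.aemeasurable
    (continuous_stackedHVI r F).aestronglyMeasurable).symm

/-- The pairs of a mean vector and a root of a covariance matrix that are bounded by `B`. -/
abbrev RootBall (q M : ℕ) (B : ℝ) : Type :=
  Metric.closedBall (0 : (Fin q × Fin M → ℝ) × (Fin q × Fin M → Fin q × Fin M → ℝ)) B

instance (B : ℝ) : CompactSpace (RootBall q M B) :=
  isCompact_iff_compactSpace.1 (isCompact_closedBall _ _)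

theorem continuous_stackedHVI_affineSample (r : Fin M → ℝ) (F : Finset (Fin M → ℝ)) (B : ℝ) :
    Continuous (Function.uncurry fun (e : EuclideanSpace ℝ (Fin q × Fin M)) (θ : RootBall q M B) =>
      stackedHVI r F (affineSample θ.1 e)) :=
  (continuous_stackedHVI r F).comp
    (continuous_affineSample.comp (continuous_fst.prodMk (continuous_subtype_val.comp continuous_snd)))

theorem exists_integrable_bound_stackedHVI (r : Fin M → ℝ) (F : Finset (Fin M → ℝ)) (B : ℝ) :
    ∃ H : EuclideanSpace ℝ (Fin q × Fin M) → ℝ, Integrable H (stdGaussian _) ∧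
      ∀ e (θ : RootBall q M B), |stackedHVI r F (affineSample θ.1 e)| ≤ H e := by
  obtain ⟨C, hC⟩ := exists_norm_affineSample_le (ι := Fin q × Fin M) B
  -- `C * (1 + ‖e‖) + ‖r‖ = C * ‖e‖ + (C + ‖r‖)`.
  refine ⟨_, integrable_affine_norm_pow _ C (C + ‖r‖) M, fun e θ => ?_⟩
  rw [abs_of_nonneg (stackedHVI_nonneg r F _)]
  refine (stackedHVI_le r F _).trans (pow_le_pow_left₀ (by positivity) ?_ M)
  have := hC θ.1 (mem_closedBall_zero_iff.1 θ.2) e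
  exact le_trans (by linarith) (le_abs_self _)

theorem continuous_expectedHVI (r : Fin M → ℝ) (F : Finset (Fin M → ℝ)) (B : ℝ) :
    Continuous fun θ : RootBall q M B => expectedHVI r F θ.1 := by
  obtain ⟨H, hH, hbound⟩ := exists_integrable_bound_stackedHVI (q := q) r F B
  exact continuous_integral_of_dominated (continuous_stackedHVI_affineSample r F B) hH hbound

theorem ae_tendstoUniformly_stackedHVI_average (r : Fin M → ℝ) (F : Finset (Fin M → ℝ)) (B : ℝ)
    {Ω : Type*} [MeasurableSpace Ω] {P : Measure Ω}
    {ε : ℕ → Ω → EuclideanSpace ℝ (Fin q × Fin M)} (hindep : iIndepFun ε P)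
    (hlaw : ∀ t, HasLaw (ε t) (stdGaussian (EuclideanSpace ℝ (Fin q × Fin M))) P) :
    ∀ᵐ ω ∂P, TendstoUniformly (fun (N : ℕ) (θ : RootBall q M B) =>
        (1 / (N : ℝ)) * ∑ t ∈ Finset.range N, stackedHVI r F (affineSample θ.1 (ε t ω)))
      (fun θ => expectedHVI r F θ.1) atTop := by
  obtain ⟨H, hH, hbound⟩ := exists_integrable_bound_stackedHVI (q := q) r F B
  exact ae_tendstoUniformly_average (continuous_stackedHVI_affineSample r F B) hH hbound
    hindep hlaw

end SampleAverage

section Root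

variable {d q M : ℕ} {K : Set (Batch d q)} {μ : Batch d q → Fin q × Fin M → ℝ}
  {S L : Batch d q → Matrix (Fin q × Fin M) (Fin q × Fin M) ℝ}

/-- The diagonal of `L x * (L x)ᵀ` holds the squared row norms of `L x`, so a bound on the
continuous `S` bounds every root. -/
theorem exists_bound_mean_root (hK : IsCompact K) (hμ : ContinuousOn μ K) (hS : ContinuousOn S K)
    (hL : ∀ x ∈ K, L x * (L x).transpose = S x) :
    ∃ B, ∀ x ∈ K, ‖(μ x, fun i j => L x i j)‖ ≤ B := by
  obtain ⟨B₁, hB₁⟩ := hK.exists_bound_of_continuousOn hμ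
  have hdiag : ContinuousOn (fun x i => S x i i) K :=
    continuousOn_pi.2 fun i => (continuous_id.matrix_elem i i).comp_continuousOn hS
  obtain ⟨B₂, hB₂⟩ := hK.exists_bound_of_continuousOn hdiag
  refine ⟨max B₁ (B₂ + 1), fun x hx => ?_⟩
  have hent : ∀ i j, |L x i j| ≤ B₂ + 1 := by
    refine abs_le_of_mul_transpose_diag_le fun i => ?_
    rw [hL x hx]
    exact (le_abs_self _).trans ((norm_le_pi_norm (fun i => S x i i) i).trans (hB₂ x hx))
  have hnn : 0 ≤ B₂ + 1 := by linarith [(norm_nonneg _).trans (hB₂ x hx)]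
  refine max_le_max (hB₁ x hx) ?_
  exact (pi_norm_le_iff_of_nonneg hnn).2 fun i => (pi_norm_le_iff_of_nonneg hnn).2 fun j => hent i j

theorem qEHVI_eq_expectedHVI (r : Fin M → ℝ) (F : Finset (Fin M → ℝ)) {x : Batch d q}
    (hx : L x * (L x).transpose = S x) :
    qEHVI r F μ S x = expectedHVI r F (μ x, fun i j => L x i j) := by
  rw [expectedHVI_eq, qEHVI, postLaw, ← hx]
  rfl

theorem continuousOn_qEHVI (r : Fin M → ℝ) (F : Finset (Fin M → ℝ)) (hK : IsCompact K)
    (hμ : ContinuousOn μ K) (hS : ContinuousOn S K)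
    (hL : ∀ x ∈ K, L x * (L x).transpose = S x) : ContinuousOn (qEHVI r F μ S) K := by
  obtain ⟨B, hB⟩ := exists_bound_mean_root hK hμ hS hL
  rw [continuousOn_iff_continuous_domRestrict]
  let θ : K → RootBall q M B := fun x =>
    ⟨(μ x, fun i j => L x i j), mem_closedBall_zero_iff.2 (hB x x.2)⟩
  -- Forgets the choice of root: `c ∘ θ` is `x ↦ (μ x, S x)`, continuous although `θ` need not be.
  let c : RootBall q M B → (Fin q × Fin M → ℝ) × Matrix (Fin q × Fin M) (Fin q × Fin M) ℝ :=
    fun θ => (θ.1.1, Matrix.of θ.1.2 * (Matrix.of θ.1.2).transpose)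
  have hof : Continuous fun θ : RootBall q M B => Matrix.of θ.1.2 :=
    continuous_snd.comp continuous_subtype_val
  have hc : Continuous c :=
    (continuous_fst.comp continuous_subtype_val).prodMk (hof.matrix_mul hof.matrix_transpose)
  have hcθ : Continuous fun x => c (θ x) := by
    have heq : (fun x => c (θ x)) = fun x : K => (μ x, S x) := by
      funext x
      exact Prod.ext rfl (hL x x.2)
    rw [heq]
    exact hμ.domRestrict.prodMk hS.domRestrict
  have hfib : ∀ a b : RootBall q M B, c a = c b → expectedHVI r F a.1 = expectedHVI r F b.1 := by
    intro a b hab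
    rw [expectedHVI_eq, expectedHVI_eq, congrArg Prod.fst hab]
    exact congrArg (fun A => ∫ v, stackedHVI r F v ∂(multivariateGaussian _ A))
      (congrArg Prod.snd hab)
  have h := continuous_comp_of_fibers hc hcθ (continuous_expectedHVI r F B) hfib
  have heq : K.domRestrict (qEHVI r F μ S) = fun x => expectedHVI r F (θ x).1 := by
    funext x
    exact qEHVI_eq_expectedHVI r F (hL x x.2)
  rwa [heq]

theorem ae_tendstoUniformlyOn_qEHVIEstimator (r : Fin M → ℝ) (F : Finset (Fin M → ℝ))
    (hK : IsCompact K) (hμ : ContinuousOn μ K) (hS : ContinuousOn S K)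
    (hL : ∀ x ∈ K, L x * (L x).transpose = S x)
    {Ω : Type*} [MeasurableSpace Ω] {P : Measure Ω}
    {ε : ℕ → Ω → EuclideanSpace ℝ (Fin q × Fin M)} (hindep : iIndepFun ε P)
    (hlaw : ∀ t, HasLaw (ε t) (stdGaussian (EuclideanSpace ℝ (Fin q × Fin M))) P) :
    ∀ᵐ ω ∂P, TendstoUniformlyOn (qEHVIEstimator r F μ L fun t => ε t ω) (qEHVI r F μ S)
      atTop K := by
  obtain ⟨B, hB⟩ := exists_bound_mean_root hK hμ hS hL
  filter_upwards [ae_tendstoUniformly_stackedHVI_average r F B hindep hlaw] with ω hω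
  rw [Metric.tendstoUniformlyOn_iff]
  intro δ hδ
  filter_upwards [Metric.tendstoUniformly_iff.1 hω δ hδ] with N hN x hx
  rw [qEHVI_eq_expectedHVI r F (hL x hx)]
  exact hN ⟨(μ x, fun i j => L x i j), mem_closedBall_zero_iff.2 (hB x hx)⟩

end Root

end QEHVI

theorem mainTheorem1 {d q M n : ℕ}
    -- compact search space
    (𝒳 : Set (QEHVI.Design d)) (h𝒳 : IsCompact 𝒳) (hne : 𝒳.Nonempty)
    -- multi-output GP prior with continuously differentiable mean and covariance functions
    {Ω₀ : Type*} [MeasurableSpace Ω₀] (P₀ : Measure Ω₀) [IsProbabilityMeasure P₀]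
    (f : QEHVI.Design d → Ω₀ → Fin M → ℝ) (hf : IsGaussianProcess f P₀)
    (hmean : ContDiff ℝ 1 (QEHVI.gpMean f P₀))
    (hcov : ∀ m m' : Fin M, ContDiff ℝ 1
      (fun z : QEHVI.Design d × QEHVI.Design d => QEHVI.gpCov f P₀ z.1 z.2 m m'))
    -- observed data, with Gaussian observation noise of covariance `Λ` (possibly zero)
    (X : Fin n → QEHVI.Design d) (Y : Fin n → Fin M → ℝ)
    (Λ : Matrix (Fin n × Fin M) (Fin n × Fin M) ℝ) (hΛ : Λ.PosSemidef)
    -- posterior mean and covariance at the stacked candidates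
    (μ : QEHVI.Batch d q → Fin q × Fin M → ℝ)
    (hμ : μ = QEHVI.postMean (QEHVI.gpMean f P₀) (QEHVI.gpCov f P₀) X Y Λ)
    (S : QEHVI.Batch d q → Matrix (Fin q × Fin M) (Fin q × Fin M) ℝ)
    (hS : S = QEHVI.postCov (QEHVI.gpCov f P₀) X Λ)
    -- a root decomposition of the posterior covariance
    (L : QEHVI.Batch d q → Matrix (Fin q × Fin M) (Fin q × Fin M) ℝ)
    (hL : ∀ x ∈ QEHVI.batches 𝒳 q, L x * (L x).transpose = S x)
    -- reference point and finite approximate Pareto set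
    (r : Fin M → ℝ) (F : Finset (Fin M → ℝ))
    -- i.i.d. standard normal base samples
    {Ω : Type*} [MeasurableSpace Ω] (P : Measure Ω) [IsProbabilityMeasure P]
    (ε : ℕ → Ω → EuclideanSpace ℝ (Fin q × Fin M))
    (hindep : iIndepFun ε P)
    (hlaw : ∀ t, HasLaw (ε t) (stdGaussian (EuclideanSpace ℝ (Fin q × Fin M))) P) :
    -- the expectation defining `α_qEHVI` exists, and `α_qEHVI` attains its maximum
    (∀ x ∈ QEHVI.batches 𝒳 q,
      Integrable (QEHVI.stackedHVI r F) (QEHVI.postLaw μ S x)) ∧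
    (QEHVI.argmaxOn (QEHVI.qEHVI r F μ S) (QEHVI.batches 𝒳 q)).Nonempty ∧
    -- almost sure convergence of every sequence of maximizers of the estimators
    ∀ xhat : ℕ → Ω → QEHVI.Batch d q,
      (∀ N, 1 ≤ N → ∀ᵐ ω ∂P, xhat N ω ∈
        QEHVI.argmaxOn (QEHVI.qEHVIEstimator r F μ L (fun t => ε t ω) N)
          (QEHVI.batches 𝒳 q)) →
      (∀ᵐ ω ∂P, Tendsto (fun N => QEHVI.qEHVI r F μ S (xhat N ω)) atTop
        (𝓝 (sSup (QEHVI.qEHVI r F μ S '' QEHVI.batches 𝒳 q)))) ∧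
      (∀ᵐ ω ∂P, Tendsto (fun N => Metric.infDist (xhat N ω)
        (QEHVI.argmaxOn (QEHVI.qEHVI r F μ S) (QEHVI.batches 𝒳 q))) atTop (𝓝 0)) := by
  have hkc : ∀ m m' : Fin M, Continuous fun z : QEHVI.Design d × QEHVI.Design d =>
      QEHVI.gpCov f P₀ z.1 z.2 m m' := fun m m' => (hcov m m').continuous
  have hμc : Continuous μ := hμ ▸ QEHVI.continuous_postMean hmean.continuous hkc Y
  have hSc : Continuous S := hS ▸ QEHVI.continuous_postCov hkc
  have hK := QEHVI.isCompact_batches h𝒳 q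
  have hα : ContinuousOn (QEHVI.qEHVI r F μ S) (QEHVI.batches 𝒳 q) :=
    QEHVI.continuousOn_qEHVI r F hK hμc.continuousOn hSc.continuousOn hL
  have hmax := QEHVI.argmaxOn_nonempty hK (QEHVI.batches_nonempty hne q) hα
  refine ⟨fun x _ => ?_, hmax, fun xhat hxhat => ?_⟩
  · unfold QEHVI.postLaw
    exact QEHVI.integrable_stackedHVI r F _
  have hae : ∀ᵐ ω ∂P, ∀ᶠ N in atTop, xhat N ω ∈
      QEHVI.argmaxOn (QEHVI.qEHVIEstimator r F μ L (fun t => ε t ω) N) (QEHVI.batches 𝒳 q) := by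
    have h : ∀ᵐ ω ∂P, ∀ N, 1 ≤ N → xhat N ω ∈
        QEHVI.argmaxOn (QEHVI.qEHVIEstimator r F μ L (fun t => ε t ω) N) (QEHVI.batches 𝒳 q) :=
      -- Countably many almost sure events, one for each `N`, hold simultaneously.
      ae_all_iff.2 fun N => eventually_imp_distrib_left.2 (hxhat N)
    filter_upwards [h] with ω hω
    exact (eventually_ge_atTop 1).mono hω
  have hval : ∀ᵐ ω ∂P, Tendsto (fun N => QEHVI.qEHVI r F μ S (xhat N ω)) atTop
      (𝓝 (sSup (QEHVI.qEHVI r F μ S '' QEHVI.batches 𝒳 q))) := by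
    filter_upwards [QEHVI.ae_tendstoUniformlyOn_qEHVIEstimator r F hK hμc.continuousOn
      hSc.continuousOn hL hindep hlaw, hae] with ω hunif hω
    exact QEHVI.tendsto_of_argmaxOn_of_tendstoUniformlyOn hunif hmax hω
  refine ⟨hval, ?_⟩
  filter_upwards [hval, hae] with ω hω hmem
  exact QEHVI.tendsto_infDist_argmaxOn hK hα hmax (hmem.mono fun N hN => hN.1) hω
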